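/- Two agents $A$ and $B$ move in the plane and execute the same deterministic algorithm. An instance is a tuple $(r,x,y,\phi,\tau,v,t,\chi)$ of real numbers with $r>0$, $0\le\phi<2\pi$, $\tau>0$, $v>0$, $t\ge 0$ and $\chi\in\{1,-1\}$. Agent $A$ starts at $(0,0)$, wakes up at time $0$, has the absolute coordinate system, time unit $1$ and speed $1$. Agent $B$ starts at $(x,y)$, wakes up at time $t$, has time unit $\tau$ and speed $v$ (hence its length unit, the distance it travels in its time unit, is $\tau v$); the $x$-axis of its coordinate system, centred at $(x,y)$, has direction $(\cos\phi,\sin\phi)$ and the $y$-axis has direction $\chi(-\sin\phi,\cos\phi)$. An algorithm is a finite or infinite sequence of instructions of the form "go $d\ge0$ length units in direction $\theta$" and "wait $z\ge0$ time units". Each agent, from its wake-up on, executes the sequence in its own coordinate system and units, and both agents stop forever as soon as they are at distance at most $r$. Rendezvous occurs if at some time the agents are at distance at most $r$ and never move after this time. The instance is feasible if there is an algorithm (which may depend on the instance, but is the same for both agents) for which rendezvous occurs. The instance is synchronous if $\tau=v=1$. Its canonical line is the line through the midpoint of $(0,0)$ and $(x,y)$ (so it is equidistant from these two points) that is parallel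 to the bisectrix of the angle between the $x$-axes of the agents, i.e. to $(\cos\frac{\phi}{2},\sin\frac{\phi}{2})$; for $\phi=0$ it is parallel to both $x$-axes. Let $proj_A$ and $proj_B$ be the orthogonal projections of $(0,0)$ and $(x,y)$ on the canonical line, and let $dist$ be the Euclidean distance. Theorem 3.1. 1. All non-synchronous instances are feasible. 2. A synchronous instance $(r,x,y,\phi,\tau,v,t,\chi)$ is feasible if and only if (a) $\chi=1$ and $\phi\neq0$, or (b) $\chi=1$ and $\phi=0$ and $t\ge dist((0,0),(x,y))-r$, or (c) $\chi=-1$ and $t\ge dist(proj_A,proj_B)-r$. -/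

import Mathlib

open scoped NNReal

namespace PlaneRV

/-- A move instruction, expressed in the private units of the executing agent.
* `go θ d`: travel `d` private length units in the direction which makes the angle `θ` with the
  private `x`-axis, turning towards the private `y`-axis (so `E, N, W, S` are
  `θ = 0, π/2, π, 3π/2`).
* `wait z`: stay idle for `z` private time units. -/
inductive Instruction where
  | go (θ : ℝ) (d : ℝ≥0)
  | wait (z : ℝ≥0)

/-- The duration of an instruction in private time units. An agent travels exactly one private
length unit per private time unit, so `go θ d` takes `d` private time units. -/
noncomputable def Instruction.duration : Instruction → ℝ
  | .go _ d => d
  | .wait z => z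

/-- The velocity during an instruction, in the private coordinates and private units.
The plane is identified with `ℂ`. -/
noncomputable def Instruction.velocity : Instruction → ℂ
  | .go θ _ => Complex.exp (θ * Complex.I)
  | .wait _ => 0

/-- A deterministic algorithm. An agent that does not see the other one receives no input, so an
algorithm amounts to the sequence of instructions that it issues until the other agent is seen.
Finite sequences are continued by instructions `wait 0`. -/
abbrev Algorithm := ℕ → Instruction

/-- The private time at which the `n`-th instruction starts. -/
noncomputable def Algorithm.startTime (P : Algorithm) (n : ℕ) : ℝ :=
  ∑ i ∈ Finset.range n, (P i).duration

/-- The amount of private time spent on the `n`-th instruction up to private time `s`. -/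
noncomputable def Algorithm.elapsed (P : Algorithm) (s : ℝ) (n : ℕ) : ℝ :=
  min (P n).duration (max 0 (s - P.startTime n))

/-- The position at private time `s`, in private coordinates and units, of an agent which executes
`P` undisturbed from the origin. After all its instructions the agent stays where it is. -/
noncomputable def Algorithm.localPos (P : Algorithm) (s : ℝ) : ℂ :=
  ∑' n, (P.elapsed s n : ℂ) * (P n).velocity

/-- The attributes of an agent: starting point, angle of the private `x`-axis, chirality, time
unit, speed, and wake-up time. All of them are in absolute terms. -/
structure Agent where
  start : ℂ
  φ : ℝ
  χ : ℤ
  τ : ℝ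
  v : ℝ
  wake : ℝ

/-- The reading of the private clock at absolute time `s`; it is `0` until the wake-up. -/
noncomputable def Agent.clock (X : Agent) (s : ℝ) : ℝ :=
  max 0 ((s - X.wake) / X.τ)

/-- The absolute vector of a vector `w` given in private coordinates and units: the private
`x`-axis points in the direction `exp (φ i)`, the private `y`-axis in the direction
`χ i exp (φ i)`, and the private length unit is `τ v`. -/
noncomputable def Agent.toAbsolute (X : Agent) (w : ℂ) : ℂ :=
  (X.τ * X.v : ℂ) * (Complex.exp (X.φ * Complex.I) * (w.re + X.χ * w.im * Complex.I))

/-- The absolute position at absolute time `s` of an agent that executes `P` without ever being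
interrupted. -/
noncomputable def Agent.soloPos (X : Agent) (P : Algorithm) (s : ℝ) : ℂ :=
  X.start + X.toAbsolute (P.localPos (X.clock s))

/-- An instance `(r, x, y, φ, τ, v, t, χ)` of the rendezvous problem. -/
structure Instance where
  r : ℝ
  x : ℝ
  y : ℝ
  φ : ℝ
  τ : ℝ
  v : ℝ
  t : ℝ
  χ : ℤ
  r_pos : 0 < r
  φ_nonneg : 0 ≤ φ
  φ_lt : φ < 2 * Real.pi
  τ_pos : 0 < τ
  v_pos : 0 < v
  t_nonneg : 0 ≤ t
  χ_eq : χ = 1 ∨ χ = -1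

namespace Instance

/-- Agent `A`, whose attributes are the absolute ones. -/
def agentA (_I : Instance) : Agent where
  start := 0
  φ := 0
  χ := 1
  τ := 1
  v := 1
  wake := 0

/-- Agent `B`, whose attributes are listed by the instance. -/
def agentB (I : Instance) : Agent where
  start := ⟨I.x, I.y⟩
  φ := I.φ
  χ := I.χ
  τ := I.τ
  v := I.v
  wake := I.t

/-- Both agents are interrupted for good as soon as they are at distance at most `r`. This is the
time up to which the algorithm has been executed at time `s ≥ 0`: it is `s` if the agents have
not been at distance at most `r` so far, and the first time at which they are otherwise. -/
noncomputable def activeTime (I : Instance) (P : Algorithm) (s : ℝ) : ℝ :=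
  sInf ({s} ∪ {u | 0 ≤ u ∧ dist (I.agentA.soloPos P u) (I.agentB.soloPos P u) ≤ I.r})

/-- The position of agent `A` at time `s` when both agents execute `P`. -/
noncomputable def posA (I : Instance) (P : Algorithm) (s : ℝ) : ℂ :=
  I.agentA.soloPos P (I.activeTime P s)

/-- The position of agent `B` at time `s` when both agents execute `P`. -/
noncomputable def posB (I : Instance) (P : Algorithm) (s : ℝ) : ℂ :=
  I.agentB.soloPos P (I.activeTime P s)

/-- `P` guarantees rendezvous: at some time the agents are at distance at most `r` of each other
and never move after this time. -/
def Rendezvous (I : Instance) (P : Algorithm) : Prop :=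
  ∃ z : ℝ, 0 ≤ z ∧ dist (I.posA P z) (I.posB P z) ≤ I.r ∧
    ∀ s : ℝ, z ≤ s → I.posA P s = I.posA P z ∧ I.posB P s = I.posB P z

/-- An instance is feasible if some algorithm, possibly designed for this instance but executed
by both agents, guarantees rendezvous for it. -/
def Feasible (I : Instance) : Prop :=
  ∃ P : Algorithm, I.Rendezvous P

/-- Clock rates and speeds of both agents are the same. -/
def Synchronous (I : Instance) : Prop :=
  I.τ = 1 ∧ I.v = 1

/-- The canonical line: the line equidistant from the two starting points (namely, through their
midpoint, so that they are not strictly on the same side of it) which is parallel to the bisectrix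
of the angle between the `x`-axes of the agents, that is, to `exp (φ i / 2)`. For `φ = 0` this is
the common direction of the `x`-axes. -/
noncomputable def canonicalLine (I : Instance) : AffineSubspace ℝ ℂ :=
  AffineSubspace.mk' (midpoint ℝ I.agentA.start I.agentB.start)
    (Submodule.span ℝ {Complex.exp ((I.φ / 2 : ℝ) * Complex.I)})

instance (I : Instance) : Nonempty I.canonicalLine :=
  inferInstanceAs (Nonempty (AffineSubspace.mk' _ _))

instance (I : Instance) : FiniteDimensional ℝ I.canonicalLine.direction :=
  FiniteDimensional.finiteDimensional_submodule _

/-- The orthogonal projection on the canonical line of the starting point of agent `A`. -/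
noncomputable def projA (I : Instance) : ℂ :=
  EuclideanGeometry.orthogonalProjection I.canonicalLine I.agentA.start

/-- The orthogonal projection on the canonical line of the starting point of agent `B`. -/
noncomputable def projB (I : Instance) : ℂ :=
  EuclideanGeometry.orthogonalProjection I.canonicalLine I.agentB.start

end Instance

end PlaneRV

namespace PlaneRV

open Complex Finset

/-! Undisturbed trajectories are continuous, so feasibility only asks that they come within `r` once
(`feasible_iff`). Write `b` for the start of `B` and `T` for the linear map `I.agentB.toAbsolute`.
If `τ ≠ 1`, the clocks drift apart until one agent can reach the other's start while that other
agent idles. If `τ = 1` and `v ≠ 1`, or in the synchronous case if `T` is a nontrivial rotation,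
then `T` fixes only `0`. Hence `w = b + T w` is solvable, and both agents can travel by the private
vector `w` to the same point. In the remaining cases `T` is the identity or a reflection. Private
clocks differ by at most `t` and private paths are 1-Lipschitz, so the gap along the directions
fixed by `T` changes by at most `t`. That gap is `b` itself or its component along the canonical
line, and explicit two-step algorithms attain the bound. -/

theorem Instruction.duration_nonneg (i : Instruction) : 0 ≤ i.duration := by
  cases i <;> simp [Instruction.duration]

theorem Instruction.norm_velocity_le (i : Instruction) : ‖i.velocity‖ ≤ 1 := by
  cases i <;> simp [Instruction.velocity, Complex.norm_exp_ofReal_mul_I]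

/-! ### Private trajectories: convergence and the Lipschitz bound. -/

namespace Algorithm

/-- The bound `max 0 s`, uniform in `n`, makes the series for `localPos` converge even when
infinitely many instructions fit into finite time. -/
theorem sum_elapsed (P : Algorithm) (s : ℝ) (n : ℕ) :
    ∑ i ∈ range n, P.elapsed s i = min (P.startTime n) (max 0 s) := by
  induction n with
  | zero => simp [startTime]
  | succ n ih =>
    have h0 : 0 ≤ P.startTime n := sum_nonneg fun i _ => (P i).duration_nonneg
    have h1 := (P n).duration_nonneg
    have h2 : P.startTime (n + 1) = P.startTime n + (P n).duration := sum_range_succ _ _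
    rw [sum_range_succ, ih, h2, elapsed]
    grind

theorem elapsed_nonneg (P : Algorithm) (s : ℝ) (n : ℕ) : 0 ≤ P.elapsed s n :=
  le_min (P n).duration_nonneg (le_max_left _ _)

theorem elapsed_mono (P : Algorithm) (n : ℕ) : Monotone fun s => P.elapsed s n := by
  intro s s' h
  simp only [elapsed]
  gcongr

theorem summable_elapsed_mul_velocity (P : Algorithm) (s : ℝ) :
    Summable fun n => (P.elapsed s n : ℂ) * (P n).velocity := by
  refine Summable.of_norm_bounded (summable_of_sum_range_le (c := max 0 s)
    (P.elapsed_nonneg s) fun n => ?_) fun n => ?_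
  · rw [sum_elapsed]
    exact min_le_right _ _
  · rw [norm_mul, Complex.norm_of_nonneg (P.elapsed_nonneg s n)]
    exact mul_le_of_le_one_right (P.elapsed_nonneg s n) (P n).norm_velocity_le

theorem norm_localPos_sub_le_of_le (P : Algorithm) {s s' : ℝ} (h : s ≤ s') :
    ‖P.localPos s' - P.localPos s‖ ≤ s' - s := by
  have hnn : ∀ n, 0 ≤ P.elapsed s' n - P.elapsed s n := fun n =>
    sub_nonneg.2 (P.elapsed_mono n h)
  have hsum : ∀ n, ∑ i ∈ range n, (P.elapsed s' i - P.elapsed s i) ≤ s' - s := fun n => by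
    rw [sum_sub_distrib, sum_elapsed, sum_elapsed]
    have h0 : 0 ≤ P.startTime n := sum_nonneg fun i _ => (P i).duration_nonneg
    grind
  rw [localPos, localPos, ← (P.summable_elapsed_mul_velocity s').tsum_sub
    (P.summable_elapsed_mul_velocity s)]
  refine (tsum_of_norm_bounded (summable_of_sum_range_le hnn hsum).hasSum fun n => ?_).trans
    (Real.tsum_le_of_sum_range_le hnn hsum)
  rw [← sub_mul, ← ofReal_sub, norm_mul, Complex.norm_of_nonneg (hnn n)]
  exact mul_le_of_le_one_right (hnn n) (P n).norm_velocity_le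

theorem norm_localPos_sub_le (P : Algorithm) (s s' : ℝ) :
    ‖P.localPos s - P.localPos s'‖ ≤ |s - s'| := by
  rcases le_total s s' with h | h
  · rw [norm_sub_rev, abs_sub_comm, abs_of_nonneg (sub_nonneg.2 h)]
    exact P.norm_localPos_sub_le_of_le h
  · rw [abs_of_nonneg (sub_nonneg.2 h)]
    exact P.norm_localPos_sub_le_of_le h

theorem continuous_localPos (P : Algorithm) : Continuous P.localPos := by
  refine (LipschitzWith.of_dist_le_mul (K := 1) fun s s' => ?_).continuous
  simpa [dist_eq_norm] using P.norm_localPos_sub_le s s'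

end Algorithm

theorem Agent.continuous_soloPos (X : Agent) (P : Algorithm) : Continuous (X.soloPos P) := by
  have := P.continuous_localPos
  unfold Agent.soloPos Agent.toAbsolute Agent.clock
  fun_prop

/-! ### Reduction to undisturbed trajectories. -/

namespace Instance

/-- Since the undisturbed trajectories are continuous, it suffices that they come close once. -/
theorem feasible_iff (I : Instance) :
    I.Feasible ↔ ∃ (P : Algorithm) (u : ℝ), 0 ≤ u ∧
      dist (I.agentA.soloPos P u) (I.agentB.soloPos P u) ≤ I.r := by
  constructor
  · rintro ⟨P, z, hz, hd, -⟩
    refine ⟨P, I.activeTime P z, Real.sInf_nonneg ?_, hd⟩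
    rintro u (rfl | hu)
    exacts [hz, hu.1]
  · rintro ⟨P, u, hu, hd⟩
    set S : Set ℝ := {u | 0 ≤ u ∧ dist (I.agentA.soloPos P u) (I.agentB.soloPos P u) ≤ I.r}
      with hS
    have hbdd : BddBelow S := ⟨0, fun _ h => h.1⟩
    have hclosed : IsClosed S :=
      (isClosed_le continuous_const continuous_id).inter
        (isClosed_le ((I.agentA.continuous_soloPos P).dist (I.agentB.continuous_soloPos P))
          continuous_const)
    have hmem : sInf S ∈ S := hclosed.csInf_mem ⟨u, hu, hd⟩ hbdd
    have hact : ∀ s, sInf S ≤ s → I.activeTime P s = sInf S := fun s hs => by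
      rw [activeTime, ← hS, csInf_union (bddBelow_singleton) (Set.singleton_nonempty s) hbdd
        ⟨u, hu, hd⟩, csInf_singleton]
      exact inf_eq_right.2 hs
    refine ⟨P, sInf S, hmem.1, ?_, fun s hs => ?_⟩
    · rw [posA, posB, hact _ le_rfl]
      exact hmem.2
    · simp only [posA, posB, hact _ le_rfl, hact s hs, and_self]

theorem soloPos_agentA (I : Instance) (P : Algorithm) {s : ℝ} (hs : 0 ≤ s) :
    I.agentA.soloPos P s = P.localPos s := by
  simp [Agent.soloPos, Agent.toAbsolute, Agent.clock, agentA, hs, Complex.re_add_im]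

theorem soloPos_agentB (I : Instance) (P : Algorithm) (s : ℝ) :
    I.agentB.soloPos P s =
      ⟨I.x, I.y⟩ + I.agentB.toAbsolute (P.localPos (max 0 ((s - I.t) / I.τ))) := rfl

end Instance

/-! ### Algorithms with two instructions. -/

/-- The instruction to travel by the private vector `w`. -/
noncomputable def Instruction.travel (w : ℂ) : Instruction := .go (arg w) ‖w‖₊

@[simp]
theorem Instruction.duration_travel (w : ℂ) : (travel w).duration = ‖w‖ := rfl

@[simp]
theorem Instruction.duration_wait (z : ℝ≥0) : (wait z).duration = z := rfl

@[simp]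
theorem Instruction.velocity_wait (z : ℝ≥0) : (wait z).velocity = 0 := rfl

@[simp]
theorem Instruction.norm_mul_velocity_travel (w : ℂ) : ‖w‖ * (travel w).velocity = w :=
  Complex.norm_mul_exp_arg_mul_I w

/-- The algorithm which consists of two instructions. -/
noncomputable def Algorithm.pair (i j : Instruction) : Algorithm
  | 0 => i
  | 1 => j
  | _ + 2 => .wait 0

namespace Algorithm

theorem localPos_pair (i j : Instruction) (s : ℝ) :
    (pair i j).localPos s = (min i.duration (max 0 s) : ℝ) * i.velocity +
      (min j.duration (max 0 (s - i.duration)) : ℝ) * j.velocity := by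
  rw [localPos, tsum_eq_sum (s := range 2)]
  · simp [sum_range_succ, elapsed, startTime, pair]
  · intro n hn
    obtain ⟨n, rfl⟩ := Nat.exists_eq_add_of_le' (not_lt.1 (mt mem_range.2 hn))
    simp [pair]

theorem localPos_pair_of_le_duration (i j : Instruction) {s : ℝ} (h0 : 0 ≤ s)
    (hs : s ≤ i.duration) : (pair i j).localPos s = s * i.velocity := by
  rw [localPos_pair, max_eq_right h0, min_eq_right hs, max_eq_left (sub_nonpos.2 hs),
    min_eq_right j.duration_nonneg]
  simp

theorem localPos_pair_of_duration_le (i j : Instruction) {s : ℝ}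
    (hs : i.duration + j.duration ≤ s) :
    (pair i j).localPos s = i.duration * i.velocity + j.duration * j.velocity := by
  have hi := i.duration_nonneg
  have hj := j.duration_nonneg
  rw [localPos_pair, max_eq_right (by linarith), max_eq_right (by linarith),
    min_eq_left (by linarith), min_eq_left (by linarith)]

end Algorithm

@[simp]
theorem Agent.toAbsolute_zero (X : Agent) : X.toAbsolute 0 = 0 := by
  simp [Agent.toAbsolute]

/-! ### The coordinate change of `B`, and sufficient conditions. -/

namespace Instance

open Instruction Algorithm

theorem toAbsolute_agentB_of_χ_eq_one {I : Instance} (hχ : I.χ = 1) (w : ℂ) :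
    I.agentB.toAbsolute w = I.τ * I.v * (exp (I.φ * Complex.I) * w) := by
  simp [Agent.toAbsolute, agentB, hχ, Complex.re_add_im]

theorem toAbsolute_agentB_of_χ_eq_neg_one {I : Instance} (hχ : I.χ = -1) (w : ℂ) :
    I.agentB.toAbsolute w =
      I.τ * I.v * (exp (I.φ * Complex.I) * (starRingEnd ℂ) w) := by
  have : (starRingEnd ℂ) w = w.re + -(w.im * Complex.I) := by
    apply Complex.ext <;> simp
  simp [Agent.toAbsolute, agentB, hχ, this]

theorem norm_toAbsolute_agentB (I : Instance) (w : ℂ) :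
    ‖I.agentB.toAbsolute w‖ = I.τ * I.v * ‖w‖ := by
  rcases I.χ_eq with h | h
  · simp [toAbsolute_agentB_of_χ_eq_one h, norm_exp_ofReal_mul_I, abs_of_pos I.τ_pos,
      abs_of_pos I.v_pos]
  · simp [toAbsolute_agentB_of_χ_eq_neg_one h, norm_exp_ofReal_mul_I, abs_of_pos I.τ_pos,
      abs_of_pos I.v_pos]

/-- The change of coordinates of agent `B` as a real linear map. -/
noncomputable def toAbsoluteLinear (I : Instance) : ℂ →ₗ[ℝ] ℂ where
  toFun := I.agentB.toAbsolute
  map_add' w z := by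
    simp only [Agent.toAbsolute, add_re, add_im, ofReal_add]
    ring
  map_smul' c w := by
    simp only [Agent.toAbsolute, real_smul, re_ofReal_mul, im_ofReal_mul, ofReal_mul,
      RingHom.id_apply]
    ring

theorem toAbsolute_agentB_surjective (I : Instance) :
    Function.Surjective I.agentB.toAbsolute := by
  refine (LinearMap.injective_iff_surjective (f := I.toAbsoluteLinear)).1
    ((injective_iff_map_eq_zero _).2 fun w hw => ?_)
  have h := I.norm_toAbsolute_agentB w
  rw [show I.agentB.toAbsolute w = 0 from hw, norm_zero] at h
  simpa [I.τ_pos.ne', I.v_pos.ne'] using h.symm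

/-- In finite dimension the injective map `id - T` is surjective. -/
theorem exists_eq_add_toAbsolute {I : Instance}
    (h : ∀ w, I.agentB.toAbsolute w = w → w = 0) (b : ℂ) :
    ∃ w, w = b + I.agentB.toAbsolute w := by
  have hinj : Function.Injective (LinearMap.id - I.toAbsoluteLinear : ℂ →ₗ[ℝ] ℂ) :=
    (injective_iff_map_eq_zero _).2 fun w hw => h w (sub_eq_zero.1 hw).symm
  obtain ⟨w, hw⟩ := LinearMap.injective_iff_surjective.1 hinj b
  exact ⟨w, sub_eq_iff_eq_add.1 hw⟩

/-- If the private coordinate systems have a common point, then both agents can go there. -/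
theorem feasible_of_eq_add_toAbsolute {I : Instance} {w : ℂ}
    (hw : w = ⟨I.x, I.y⟩ + I.agentB.toAbsolute w) : I.Feasible := by
  have ht := I.t_nonneg
  have hτ := I.τ_pos
  have hp : 0 ≤ I.τ * ‖w‖ := by positivity
  have hw0 := norm_nonneg w
  refine I.feasible_iff.2 ⟨pair (travel w) (wait 0), ‖w‖ + I.t + I.τ * ‖w‖, by linarith, ?_⟩
  have hB : ‖w‖ ≤ (‖w‖ + I.t + I.τ * ‖w‖ - I.t) / I.τ := by
    rw [le_div_iff₀ hτ]
    linarith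
  rw [I.soloPos_agentA _ (by linarith), soloPos_agentB,
    localPos_pair_of_duration_le _ _ (by simp; linarith),
    localPos_pair_of_duration_le _ _ (by simpa using Or.inr hB)]
  simp [← hw, I.r_pos.le]

/-- The clock of `B` is slow: after a long enough common wait, `A` walks to the start of `B` before
`B` has finished waiting. -/
theorem feasible_of_one_lt_τ {I : Instance} (hτ : 1 < I.τ) : I.Feasible := by
  have ht := I.t_nonneg
  set b : ℂ := ⟨I.x, I.y⟩
  have hb := norm_nonneg b
  have hz : 0 ≤ ‖b‖ / (I.τ - 1) := div_nonneg hb (by linarith)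
  have hzτ : ‖b‖ / (I.τ - 1) * (I.τ - 1) = ‖b‖ := div_mul_cancel₀ _ (by linarith)
  set z : ℝ≥0 := ⟨‖b‖ / (I.τ - 1), hz⟩
  change (z : ℝ) * (I.τ - 1) = ‖b‖ at hzτ
  refine I.feasible_iff.2 ⟨pair (wait z) (travel b), z + ‖b‖, by positivity, ?_⟩
  have hB : (z + ‖b‖ - I.t) / I.τ ≤ z := by
    rw [div_le_iff₀ I.τ_pos]
    linarith
  rw [I.soloPos_agentA _ (by positivity), soloPos_agentB,
    localPos_pair_of_duration_le _ _ (by simp),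
    localPos_pair_of_le_duration _ _ (le_max_left _ _) (by simpa using hB)]
  simp [b, I.r_pos.le]

/-- The roles are exchanged: `B` waits and walks to the origin while `A` is still waiting there. -/
theorem feasible_of_τ_lt_one {I : Instance} (hτ : I.τ < 1) : I.Feasible := by
  have ht := I.t_nonneg
  have hτ0 := I.τ_pos
  obtain ⟨w, hw⟩ := I.toAbsolute_agentB_surjective (-⟨I.x, I.y⟩)
  have hw0 := norm_nonneg w
  have hp : 0 ≤ I.τ * ‖w‖ := by positivity
  have hz : 0 ≤ (I.t + I.τ * ‖w‖) / (1 - I.τ) := div_nonneg (by linarith) (by linarith)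
  have hzτ : (I.t + I.τ * ‖w‖) / (1 - I.τ) * (1 - I.τ) = I.t + I.τ * ‖w‖ :=
    div_mul_cancel₀ _ (by linarith)
  set z : ℝ≥0 := ⟨(I.t + I.τ * ‖w‖) / (1 - I.τ), hz⟩
  change (z : ℝ) * (1 - I.τ) = I.t + I.τ * ‖w‖ at hzτ
  refine I.feasible_iff.2 ⟨pair (wait z) (travel w), z, z.coe_nonneg, ?_⟩
  have hB : z + ‖w‖ ≤ (z - I.t) / I.τ := by
    rw [le_div_iff₀ hτ0]
    linarith
  rw [I.soloPos_agentA _ z.coe_nonneg, soloPos_agentB,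
    localPos_pair_of_le_duration _ _ z.coe_nonneg (by simp),
    localPos_pair_of_duration_le _ _ (by simpa using Or.inr hB)]
  simp [hw, I.r_pos.le]

theorem feasible_of_not_synchronous {I : Instance} (h : ¬ I.Synchronous) : I.Feasible := by
  rcases lt_trichotomy I.τ 1 with hτ | hτ | hτ
  · exact feasible_of_τ_lt_one hτ
  · have hv : I.v ≠ 1 := fun hv => h ⟨hτ, hv⟩
    obtain ⟨w, hw⟩ := I.exists_eq_add_toAbsolute (fun w hw => by
      have hn := I.norm_toAbsolute_agentB w
      rw [hw, hτ, one_mul] at hn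
      by_contra hw0
      exact hv (mul_right_cancel₀ (norm_ne_zero_iff.2 hw0) (by linarith))) ⟨I.x, I.y⟩
    exact feasible_of_eq_add_toAbsolute hw
  · exact feasible_of_one_lt_τ hτ

theorem feasible_of_φ_ne_zero {I : Instance} (hI : I.Synchronous) (hχ : I.χ = 1)
    (hφ : I.φ ≠ 0) : I.Feasible := by
  obtain ⟨w, hw⟩ := I.exists_eq_add_toAbsolute (fun w hw => by
    rw [toAbsolute_agentB_of_χ_eq_one hχ, hI.1, hI.2] at hw
    by_contra hw0
    have h1 : exp (I.φ * Complex.I) = 1 := mul_right_cancel₀ hw0 (by simpa using hw)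
    obtain ⟨n, hn⟩ := Complex.exp_eq_one_iff.1 h1
    have hn' : I.φ = n * (2 * Real.pi) := by
      have := congrArg Complex.im hn
      simpa using this
    have hpi := Real.two_pi_pos
    have h0 : 0 < I.φ := lt_of_le_of_ne I.φ_nonneg (Ne.symm hφ)
    have hlt := I.φ_lt
    rw [hn'] at h0 hlt
    have hn0 : (0 : ℝ) < n := pos_of_mul_pos_left h0 hpi.le
    have hn1 : (n : ℝ) < 1 := by nlinarith
    norm_cast at hn0 hn1
    omega) ⟨I.x, I.y⟩
  exact feasible_of_eq_add_toAbsolute hw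

/-- `A` walks straight towards `B`, which sleeps until time `t`. -/
theorem feasible_of_norm_sub_le {I : Instance} (h : ‖(⟨I.x, I.y⟩ : ℂ)‖ - I.r ≤ I.t) :
    I.Feasible := by
  have ht := I.t_nonneg
  set b : ℂ := ⟨I.x, I.y⟩
  refine I.feasible_iff.2 ⟨pair (travel b) (wait 0), min I.t ‖b‖, by positivity, ?_⟩
  have hB : (min I.t ‖b‖ - I.t) / I.τ ≤ 0 :=
    div_nonpos_of_nonpos_of_nonneg (by simp) I.τ_pos.le
  rw [I.soloPos_agentA _ (by positivity), soloPos_agentB, max_eq_left hB,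
    localPos_pair_of_le_duration _ _ le_rfl (norm_nonneg _),
    localPos_pair_of_le_duration _ _ (by positivity)
      (by simp)]
  have hbv : ‖b‖ * (travel b).velocity = b := norm_mul_velocity_travel b
  have : ((min I.t ‖b‖ : ℝ) : ℂ) * (travel b).velocity - b =
      ((min I.t ‖b‖ - ‖b‖ : ℝ) : ℂ) * (travel b).velocity := by
    rw [ofReal_sub, sub_mul, hbv]
  rw [ofReal_zero, zero_mul, Agent.toAbsolute_zero, add_zero, dist_eq_norm, this, norm_mul,
    norm_real, Real.norm_eq_abs]
  refine (mul_le_of_le_one_right (abs_nonneg _) (norm_velocity_le _)).trans ?_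
  have := I.r_pos
  rw [abs_of_nonpos (by simp)]
  grind

/-! ### The canonical line and opposite chiralities. -/

/-- The unit vector along the canonical line. -/
noncomputable def lineDir (I : Instance) : ℂ := exp ((I.φ / 2 : ℝ) * Complex.I)

theorem norm_lineDir (I : Instance) : ‖I.lineDir‖ = 1 := norm_exp_ofReal_mul_I _

theorem lineDir_mul_conj (I : Instance) : I.lineDir * (starRingEnd ℂ) I.lineDir = 1 := by
  rw [mul_conj, normSq_eq_norm_sq, norm_lineDir]
  simp

theorem lineDir_mul_self (I : Instance) : I.lineDir * I.lineDir = exp (I.φ * Complex.I) := by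
  rw [lineDir, ← Complex.exp_add]
  push_cast
  ring_nf

/-- The linear part of the affine projection is the projection onto the direction, here applied to
the difference of the starts. -/
theorem dist_projA_projB (I : Instance) :
    dist I.projA I.projB = |((starRingEnd ℂ) I.lineDir * ⟨I.x, I.y⟩).re| := by
  have hdir : I.canonicalLine.direction = Submodule.span ℝ {I.lineDir} :=
    AffineSubspace.direction_mk' _ _
  have hvsub : I.projB - I.projA =
      I.canonicalLine.direction.starProjection (⟨I.x, I.y⟩ : ℂ) := by
    have h := (EuclideanGeometry.orthogonalProjection I.canonicalLine).toAffineMap.linearMap_vsub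
      I.agentB.start I.agentA.start
    have h' := congrArg (Subtype.val) h
    simp [agentA, agentB] at h'
    exact h'.symm
  rw [dist_comm, dist_eq_norm, hvsub]
  simp only [hdir]
  rw [Submodule.starProjection_unit_singleton ℝ I.norm_lineDir, norm_smul, norm_lineDir,
    mul_one, Complex.inner, Real.norm_eq_abs, mul_comm]

theorem feasible_of_χ_eq_neg_one {I : Instance} (hI : I.Synchronous) (hχ : I.χ = -1)
    (h : dist I.projA I.projB - I.r ≤ I.t) : I.Feasible := by
  have ht := I.t_nonneg
  have hr := I.r_pos
  rw [dist_projA_projB] at h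
  obtain ⟨c, hc⟩ : ∃ c, (starRingEnd ℂ) I.lineDir * ⟨I.x, I.y⟩ = c := ⟨_, rfl⟩
  rw [hc] at h
  have hb : (⟨I.x, I.y⟩ : ℂ) = I.lineDir * c := by
    rw [← hc, ← mul_assoc, lineDir_mul_conj, one_mul]
  -- the agents first go to the canonical line, then along it
  set w : ℂ := I.lineDir * ((c.im / 2 : ℝ) * Complex.I) with hw
  -- `m` is `c.re` clamped to `[-t, t]`: `A` can finish this move by time `‖w‖ + t`, when `B` has
  -- just reached the line.
  obtain ⟨m, hm, hm'⟩ : ∃ m : ℝ, |m| ≤ I.t ∧ |m - c.re| ≤ I.r := by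
    refine ⟨max (-I.t) (min I.t c.re), ?_, ?_⟩ <;> grind
  have hw0 := norm_nonneg w
  refine I.feasible_iff.2 ⟨pair (travel w) (travel (I.lineDir * m)), ‖w‖ + I.t, by linarith, ?_⟩
  have hB : max 0 ((‖w‖ + I.t - I.t) / I.τ) = ‖w‖ := by simp [hI.1]
  rw [I.soloPos_agentA _ (by linarith), soloPos_agentB, hB,
    localPos_pair_of_le_duration _ _ hw0 le_rfl,
    localPos_pair_of_duration_le _ _ (by simp [norm_lineDir, hm]), duration_travel,
    duration_travel, norm_mul_velocity_travel, norm_mul_velocity_travel,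
    toAbsolute_agentB_of_χ_eq_neg_one hχ, hI.1, hI.2, hb, ← lineDir_mul_self, dist_eq_norm]
  have hconj : (starRingEnd ℂ) w =
      (starRingEnd ℂ) I.lineDir * (-((c.im / 2 : ℝ) * Complex.I)) := by
    rw [hw, map_mul, map_mul, conj_I, conj_ofReal, mul_neg]
  have key : w + I.lineDir * m - (I.lineDir * c + (1 : ℝ) * (1 : ℝ) *
      (I.lineDir * I.lineDir * (starRingEnd ℂ) w)) = I.lineDir * ((m - c.re : ℝ) : ℂ) := by
    rw [hconj, hw]
    push_cast
    linear_combination (I.lineDir * (c.im / 2 * Complex.I)) * I.lineDir_mul_conj +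
      I.lineDir * re_add_im c
  rw [key, norm_mul, norm_lineDir, one_mul, norm_real, Real.norm_eq_abs]
  exact hm'

/-! ### Necessary conditions for synchronous instances. -/

theorem abs_sub_max_le {I : Instance} (hI : I.Synchronous) {u : ℝ} (hu : 0 ≤ u) :
    |u - max 0 ((u - I.t) / I.τ)| ≤ I.t := by
  have ht := I.t_nonneg
  rw [hI.1, div_one]
  grind

theorem norm_sub_le_of_feasible {I : Instance} (hI : I.Synchronous) (hχ : I.χ = 1)
    (hφ : I.φ = 0) (h : I.Feasible) : ‖(⟨I.x, I.y⟩ : ℂ)‖ - I.r ≤ I.t := by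
  obtain ⟨P, u, hu, hd⟩ := I.feasible_iff.1 h
  rw [I.soloPos_agentA _ hu, soloPos_agentB, toAbsolute_agentB_of_χ_eq_one hχ, hI.2, hφ,
    dist_comm, dist_eq_norm] at hd
  have hL := (P.norm_localPos_sub_le u _).trans (abs_sub_max_le hI hu)
  set s := max 0 ((u - I.t) / I.τ)
  rw [hI.1] at hd
  -- The vector `b` is the final gap, at most `r`, plus the difference of two points of one private
  -- path, at most `t`.
  have := norm_add_le ((⟨I.x, I.y⟩ : ℂ) + ((1 : ℝ) * (1 : ℝ) *
    (exp ((0 : ℝ) * Complex.I) * P.localPos s)) - P.localPos u) (P.localPos u - P.localPos s)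
  have e : (⟨I.x, I.y⟩ : ℂ) + ((1 : ℝ) * (1 : ℝ) *
    (exp ((0 : ℝ) * Complex.I) * P.localPos s)) - P.localPos u +
      (P.localPos u - P.localPos s) = ⟨I.x, I.y⟩ := by simp
  rw [e] at this
  linarith

theorem dist_proj_sub_le_of_feasible {I : Instance} (hI : I.Synchronous) (hχ : I.χ = -1)
    (h : I.Feasible) : dist I.projA I.projB - I.r ≤ I.t := by
  obtain ⟨P, u, hu, hd⟩ := I.feasible_iff.1 h
  rw [I.soloPos_agentA _ hu, soloPos_agentB, toAbsolute_agentB_of_χ_eq_neg_one hχ, hI.2,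
    dist_comm, dist_eq_norm] at hd
  have hL := (P.norm_localPos_sub_le u _).trans (abs_sub_max_le hI hu)
  set s := max 0 ((u - I.t) / I.τ)
  rw [hI.1, ← lineDir_mul_self] at hd
  rw [dist_projA_projB]
  set D := I.lineDir
  set b : ℂ := ⟨I.x, I.y⟩
  set a := P.localPos u
  set a' := P.localPos s
  have hD : ‖(starRingEnd ℂ) D‖ = 1 := by rw [RCLike.norm_conj]; exact I.norm_lineDir
  have hDD : D * (starRingEnd ℂ) D = 1 := I.lineDir_mul_conj
  -- reflecting a vector in the canonical line does not change its component along it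
  have hre : ((starRingEnd ℂ) D * b).re =
      ((starRingEnd ℂ) D * (b + (1 : ℝ) * (1 : ℝ) * (D * D * (starRingEnd ℂ) a') - a)).re +
      ((starRingEnd ℂ) D * (a - a')).re := by
    have e1 : (starRingEnd ℂ) D * (b + (1 : ℝ) * (1 : ℝ) * (D * D * (starRingEnd ℂ) a') - a) =
        (starRingEnd ℂ) D * b + D * (starRingEnd ℂ) a' - (starRingEnd ℂ) D * a := by
      push_cast
      linear_combination (D * (starRingEnd ℂ) a') * hDD
    have e2 : (D * (starRingEnd ℂ) a').re = ((starRingEnd ℂ) D * a').re := by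
      simp
    rw [e1, mul_sub, sub_re, add_re, sub_re, e2]
    ring
  have h1 := (abs_re_le_norm ((starRingEnd ℂ) D *
    (b + (1 : ℝ) * (1 : ℝ) * (D * D * (starRingEnd ℂ) a') - a)))
  have h2 := (abs_re_le_norm ((starRingEnd ℂ) D * (a - a')))
  rw [norm_mul, hD, one_mul] at h1 h2
  rw [hre]
  refine sub_le_iff_le_add.2 ((abs_add_le _ _).trans ?_)
  linarith

end Instance

end PlaneRV

theorem theorem3p1 :
    (∀ I : PlaneRV.Instance, ¬ I.Synchronous → I.Feasible) ∧
    (∀ I : PlaneRV.Instance, I.Synchronous →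
      (I.Feasible ↔
        (I.χ = 1 ∧ I.φ ≠ 0) ∨
        (I.χ = 1 ∧ I.φ = 0 ∧ I.t ≥ dist (0 : ℂ) ⟨I.x, I.y⟩ - I.r) ∨
        (I.χ = -1 ∧ I.t ≥ dist I.projA I.projB - I.r))) := by
  refine ⟨fun I => PlaneRV.Instance.feasible_of_not_synchronous, fun I hI => ?_⟩
  rw [dist_zero_left]
  constructor
  · intro h
    rcases I.χ_eq with hχ | hχ
    · by_cases hφ : I.φ = 0
      · exact Or.inr (Or.inl ⟨hχ, hφ, I.norm_sub_le_of_feasible hI hχ hφ h⟩)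
      · exact Or.inl ⟨hχ, hφ⟩
    · exact Or.inr (Or.inr ⟨hχ, I.dist_proj_sub_le_of_feasible hI hχ h⟩)
  · rintro (⟨hχ, hφ⟩ | ⟨-, -, h⟩ | ⟨hχ, h⟩)
    · exact I.feasible_of_φ_ne_zero hI hχ hφ
    · exact I.feasible_of_norm_sub_le h
    · exact I.feasible_of_χ_eq_neg_one hI hχ h
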